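/- Let $d\ge 1$ and let $\mathbb{R}_d$ be the real Clifford algebra with imaginary units $e_1,\dots,e_d$, $e_i^2=-1$, $e_ie_j=-e_je_i$ ($i\ne j$), and basis $(e_A)_A$, where $e_A=e_{i_1}\cdots e_{i_r}$ for $A=\{i_1<\dots<i_r\}$. For $s=\sum_A s_Ae_A$ put $|s|^2=\sum_A s_A^2$ and $\overline{s}=\sum_A(-1)^{|A|(|A|+1)/2}s_Ae_A$. Paravectors are the elements $s=s_0+s_1e_1+\dots+s_de_d$, identified with $\mathbb{R}^{d+1}$; write $\operatorname{Im}(s)=s_1e_1+\dots+s_de_d$ and $\operatorname{Arg}(s)=\arg(s_0+i|\operatorname{Im}(s)|)\in[0,\pi]$ for $s\neq0$. Let $V_{\mathbb{R}}$ be a real Hilbert space and let $V=\{\sum_A v_A\otimes e_A : v_A\in V_{\mathbb{R}}\}$ be the corresponding Hilbert module, with the left and right multiplications by $\mathbb{R}_d$ induced from the product of $\mathbb{R}_d$, with $\langle v,w\rangle=\sum_{A,B}\langle v_A,w_B\rangle_{\mathbb{R}}\,\overline{e_A}e_B$ and $\|v\|^2=\operatorname{Sc}\langle v,v\rangle=\sum_A\|v_A\|^2$.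 Let $\mathcal{B}(V)$ be the set of bounded everywhere defined right-linear operators and $\mathcal{K}(V)$ the set of closed right-linear operators $T:\operatorname{dom}(T)\subseteq V\to V$, where $\operatorname{dom}(T)$ is a right-linear subspace. For $T\in\mathcal{K}(V)$ and a paravector $s$ let $Q_s[T]=T^2-2s_0T+|s|^2$ with domain $\operatorname{dom}(T^2)$, let $\rho_S(T)=\{s\in\mathbb{R}^{d+1} : Q_s[T]^{-1}\in\mathcal{B}(V)\}$, $\sigma_S(T)=\mathbb{R}^{d+1}\setminus\rho_S(T)$, and for $s\in\rho_S(T)$ let $S_L^{-1}(s,T)=Q_s[T]^{-1}\overline{s}-TQ_s[T]^{-1}$. For $\omega\in(0,\frac{\pi}{2})$ let $D_\omega=\{s\in\mathbb{R}^{d+1}\setminus\{0\} : \operatorname{Arg}(s)\in(-\omega,\omega)\cup(\pi-\omega,\pi+\omega)\}$. An operator $T\in\mathcal{K}(V)$ is called bisectorial of angle $\omega$ if $\sigma_S(T)\subseteq\overline{D_\omega}$ and if for every $\varphi\in(\omega,\frac{\pi}{2})$ there is some $C_\varphi\ge0$ such that $$\|S_L^{-1}(s,T)\|\le\frac{C_\varphi}{|s|}\qquad\text{for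 all }s\in\mathbb{R}^{d+1}\setminus(D_\varphi\cup\{0\}).$$ Statement: Let $\omega\in(0,\frac{\pi}{2})$ and let $T\in\mathcal{K}(V)$ be bisectorial of angle $\omega$. Then $T$ is densely defined, and its adjoint $T^*$, defined by $\operatorname{Sc}\langle T^*w,v\rangle=\operatorname{Sc}\langle w,Tv\rangle$ for $v\in\operatorname{dom}(T)$ on the set of all $w\in V$ for which such an element $T^*w\in V$ exists, again belongs to $\mathcal{K}(V)$ and is bisectorial of the same angle $\omega$. -/

import Mathlib

open scoped InnerProductSpace

noncomputable section

namespace Clifford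

/-! ### The Clifford algebra `ℝ_d` and Hilbert modules over it -/

/-- The space `V = { ∑_A v_A ⊗ e_A }` over a real normed space `H`, where the multi-indices
`1 ≤ i₁ < ⋯ < i_r ≤ d` are the subsets `A` of `Fin d`. The norm is `‖v‖² = ∑_A ‖v_A‖²`; if `H` is
a Hilbert space the real inner product is `∑_A ⟪v_A, w_A⟫`, the scalar part of the full
Clifford-valued inner product (see `scalarPart_fullInner`). -/
abbrev HilbertModule (d : ℕ) (H : Type*) : Type _ := PiLp 2 (fun _ : Finset (Fin d) => H)

/-- The Clifford numbers `s = ∑_A s_A e_A`, with absolute value `|s|² = ∑_A s_A²`. -/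
abbrev Number (d : ℕ) : Type := HilbertModule d ℝ

variable {d : ℕ} {H : Type*} [NormedAddCommGroup H] [InnerProductSpace ℝ H]

/-- The basis vector `e_A`. -/
def e (A : Finset (Fin d)) : Number d := EuclideanSpace.single A 1

/-- The sign in `e_A e_B = sign A B • e_(A ∆ B)`: a factor `-1` for every transposition of
`e_a` and `e_b` with `b < a`, and a factor `-1` for every square `e_a e_a`. -/
def sign (A B : Finset (Fin d)) : ℝ := ∏ a ∈ A, ∏ b ∈ B, if b ≤ a then -1 else 1

/-- Left multiplication `s v = ∑_{A,B} (s_B v_A) ⊗ (e_B e_A)`. The coefficient of `e_C` collects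
the pairs with `B ∆ A = C`, that is `A = B ∆ C`. -/
def leftMul (s : Number d) (v : HilbertModule d H) : HilbertModule d H :=
  WithLp.toLp 2 fun C => ∑ B, (sign B (symmDiff B C) * s B) • v (symmDiff B C)

/-- Right multiplication `v s = ∑_{A,B} (v_A s_B) ⊗ (e_A e_B)`. The coefficient of `e_C` collects
the pairs with `A ∆ B = C`, that is `A = B ∆ C`. -/
def rightMul (v : HilbertModule d H) (s : Number d) : HilbertModule d H :=
  WithLp.toLp 2 fun C => ∑ B, (sign (symmDiff B C) B * s B) • v (symmDiff B C)

/-- The product of Clifford numbers. -/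
def mul (s t : Number d) : Number d := leftMul s t

/-- The conjugate `∑_A (-1)^(|A|(|A|+1)/2) s_A e_A`. -/
def conj (s : Number d) : Number d :=
  WithLp.toLp 2 fun A => (-1) ^ (A.card * (A.card + 1) / 2) * s A

/-- The Clifford-valued inner product `⟨v, w⟩ = ∑_{A,B} ⟪v_A, w_B⟫ conj(e_A) e_B`. -/
def fullInner (v w : HilbertModule d H) : Number d :=
  ∑ A, ∑ B, ⟪v A, w B⟫_ℝ • mul (conj (e A)) (e B)

/-! Checks: the product satisfies the defining relations of `ℝ_d`, it is associative, `V` is a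
two-sided module, and the real inner product of `V` is the scalar part of the full one. -/

theorem sign_mul_self (A B : Finset (Fin d)) : sign A B * sign A B = 1 := by
  simp only [sign, ← Finset.prod_mul_distrib]
  refine Finset.prod_eq_one fun a _ => Finset.prod_eq_one fun b _ => ?_
  split_ifs <;> norm_num

theorem mul_e_e (A B : Finset (Fin d)) : mul (e A) (e B) = sign A B • e (symmDiff A B) := by
  ext C
  have h : symmDiff A C = B ↔ C = symmDiff A B := by
    constructor
    · rintro rfl; simp
    · rintro rfl; simp
  rw [mul, leftMul]
  simp only [e, PiLp.smul_apply, PiLp.single_apply, smul_eq_mul]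
  rw [Finset.sum_eq_single A]
  · by_cases hC : C = symmDiff A B
    · subst hC; simp
    · rw [if_neg (mt h.1 hC), if_neg hC]; simp
  · intro D _ hD; simp [hD]
  · simp

theorem rightMul_eq_mul (s t : Number d) : rightMul s t = mul s t := by
  ext C
  simp only [rightMul, mul, leftMul, PiLp.toLp_apply, smul_eq_mul]
  refine Finset.sum_nbij' (fun B => symmDiff B C) (fun B => symmDiff B C) ?_ ?_ ?_ ?_ ?_ <;>
    intros <;> simp [mul_comm, mul_left_comm, mul_assoc]

theorem mul_e_self (i : Fin d) : mul (e {i}) (e {i}) = -e ∅ := by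
  rw [mul_e_e]; simp [sign]

theorem mul_e_anticomm {i j : Fin d} (h : i ≠ j) :
    mul (e {i}) (e {j}) = -mul (e {j}) (e {i}) := by
  rw [mul_e_e, mul_e_e, symmDiff_comm ({j} : Finset (Fin d)) {i}, ← neg_smul]
  congr 1
  rcases lt_or_gt_of_ne h with h | h <;> simp [sign, h.le, h.not_ge]

/-- `e_A` is the increasing product of the imaginary units `e_i`, `i ∈ A`. -/
theorem mul_e_insert {i : Fin d} {A : Finset (Fin d)} (h : ∀ j ∈ A, i < j) :
    mul (e {i}) (e A) = e (insert i A) := by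
  have h1 : sign {i} A = 1 := by
    rw [sign, Finset.prod_singleton]
    exact Finset.prod_eq_one fun b hb => if_neg (h b hb).not_ge
  have h2 : symmDiff {i} A = insert i A := by
    ext k
    simp only [Finset.mem_symmDiff, Finset.mem_singleton, Finset.mem_insert]
    constructor
    · tauto
    · rintro (rfl | hk)
      · exact Or.inl ⟨rfl, fun hk => lt_irrefl _ (h _ hk)⟩
      · exact Or.inr ⟨hk, fun hki => lt_irrefl _ (hki ▸ h _ hk)⟩
  rw [mul_e_e, h1, h2, one_smul]

theorem sign_symmDiff_left (A B C : Finset (Fin d)) :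
    sign (symmDiff A B) C = sign A C * sign B C := by
  simp only [sign]
  rw [← Fintype.prod_ite_mem (symmDiff A B), ← Fintype.prod_ite_mem A, ← Fintype.prod_ite_mem B,
    ← Finset.prod_mul_distrib]
  refine Finset.prod_congr rfl fun a _ => ?_
  have h := sign_mul_self {a} C
  simp only [sign, Finset.prod_singleton] at h
  by_cases hA : a ∈ A <;> by_cases hB : a ∈ B <;> simp [Finset.mem_symmDiff, hA, hB, h]

theorem sign_symmDiff_right (A B C : Finset (Fin d)) :
    sign A (symmDiff B C) = sign A B * sign A C := by
  simp only [sign, ← Finset.prod_mul_distrib]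
  refine Finset.prod_congr rfl fun a _ => ?_
  rw [← Fintype.prod_ite_mem (symmDiff B C), ← Fintype.prod_ite_mem B, ← Fintype.prod_ite_mem C,
    ← Finset.prod_mul_distrib]
  refine Finset.prod_congr rfl fun b _ => ?_
  by_cases hB : b ∈ B <;> by_cases hC : b ∈ C <;> by_cases hab : b ≤ a <;>
    simp [Finset.mem_symmDiff, hB, hC, hab]

theorem leftMul_leftMul (s t : Number d) (v : HilbertModule d H) :
    leftMul s (leftMul t v) = leftMul (mul s t) v := by
  ext C
  simp only [mul, leftMul, Finset.smul_sum, Finset.mul_sum, Finset.sum_smul, smul_smul]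
  conv_rhs => rw [Finset.sum_comm]
  refine Finset.sum_congr rfl fun B _ => ?_
  refine Finset.sum_nbij' (fun A => symmDiff B A) (fun A => symmDiff B A) (by simp) (by simp)
    (by simp) (by simp) fun A _ => ?_
  have h1 : symmDiff (symmDiff B A) C = symmDiff A (symmDiff B C) := by
    rw [symmDiff_comm B A, symmDiff_assoc]
  have h2 := sign_mul_self B A
  rw [h1, symmDiff_symmDiff_cancel_left]
  congr 1
  simp only [sign_symmDiff_left, sign_symmDiff_right, smul_eq_mul]
  linear_combination (-(sign B B * sign B C * sign A A * sign A B * sign A C * s B * t A)) * h2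

theorem mul_mul (s t u : Number d) : mul (mul s t) u = mul s (mul t u) :=
  (leftMul_leftMul s t u).symm

theorem rightMul_rightMul (v : HilbertModule d H) (s t : Number d) :
    rightMul (rightMul v s) t = rightMul v (mul s t) := by
  ext C
  simp only [← rightMul_eq_mul, rightMul, Finset.smul_sum, Finset.mul_sum, Finset.sum_smul,
    smul_smul]
  conv_rhs => rw [Finset.sum_comm]
  refine Finset.sum_congr rfl fun B _ => ?_
  refine Finset.sum_nbij' (fun A => symmDiff B A) (fun A => symmDiff B A) (by simp) (by simp)
    (by simp) (by simp) fun A _ => ?_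
  have h1 : symmDiff (symmDiff B A) C = symmDiff A (symmDiff B C) := by
    rw [symmDiff_comm B A, symmDiff_assoc]
  have h2 := sign_mul_self A B
  rw [h1, symmDiff_symmDiff_cancel_left]
  congr 1
  simp only [sign_symmDiff_left, sign_symmDiff_right, smul_eq_mul]
  linear_combination (-(sign B B * sign C B * sign A A * sign B A * sign C A * s A * t B)) * h2

theorem leftMul_rightMul (s t : Number d) (v : HilbertModule d H) :
    leftMul s (rightMul v t) = rightMul (leftMul s v) t := by
  ext C
  simp only [leftMul, rightMul, Finset.smul_sum, smul_smul]
  conv_rhs => rw [Finset.sum_comm]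
  refine Finset.sum_congr rfl fun B _ => Finset.sum_congr rfl fun A _ => ?_
  rw [symmDiff_left_comm A B C]
  congr 1
  simp only [sign_symmDiff_left, sign_symmDiff_right]
  ring

theorem leftMul_e_empty (v : HilbertModule d H) : leftMul (e ∅) v = v := by
  ext C
  simp only [leftMul, e, PiLp.single_apply]
  rw [Finset.sum_eq_single ∅]
  · simp [sign, show symmDiff ∅ C = C from bot_symmDiff C]
  · intro D _ hD; simp [hD]
  · simp

theorem rightMul_e_empty (v : HilbertModule d H) : rightMul v (e ∅) = v := by
  ext C
  simp only [rightMul, e, PiLp.single_apply]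
  rw [Finset.sum_eq_single ∅]
  · simp [sign, show symmDiff ∅ C = C from bot_symmDiff C]
  · intro D _ hD; simp [hD]
  · simp

theorem sign_self (A : Finset (Fin d)) :
    sign A A = (-1) ^ (A.card * (A.card + 1) / 2) := by
  induction A using Finset.induction_on_max with
  | empty => simp [sign]
  | insert m A hm ih =>
    have hmA : m ∉ A := fun h => lt_irrefl _ (hm m h)
    have h1 : ∏ a ∈ A, ∏ b ∈ insert m A, (if b ≤ a then (-1 : ℝ) else 1) = sign A A := by
      refine Finset.prod_congr rfl fun a ha => ?_
      rw [Finset.prod_insert hmA, if_neg (hm a ha).not_ge, one_mul]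
    have h2 : ∏ b ∈ insert m A, (if b ≤ m then (-1 : ℝ) else 1) = (-1) ^ (A.card + 1) := by
      rw [Finset.prod_congr rfl (g := fun _ => (-1 : ℝ)), Finset.prod_const,
        Finset.card_insert_of_notMem hmA]
      intro b hb
      rcases Finset.mem_insert.1 hb with rfl | hb
      · simp
      · rw [if_pos (hm b hb).le]
    rw [sign, Finset.prod_insert hmA, h1, h2, ih, Finset.card_insert_of_notMem hmA, ← pow_add]
    congr 1
    have : (A.card + 1) * (A.card + 1 + 1) = A.card * (A.card + 1) + 2 * (A.card + 1) := by ring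
    omega

theorem scalarPart_fullInner (v w : HilbertModule d H) : fullInner v w ∅ = ⟪v, w⟫_ℝ := by
  have hc (A : Finset (Fin d)) : conj (e A) = (-1 : ℝ) ^ (A.card * (A.card + 1) / 2) • e A := by
    ext B
    by_cases h : B = A
    · subst h; simp [conj, e]
    · simp [conj, e, h]
  have hm (A B : Finset (Fin d)) (c : ℝ) : mul (c • e A) (e B) = c • mul (e A) (e B) := by
    ext C
    simp only [mul, leftMul, PiLp.smul_apply, smul_eq_mul, Finset.mul_sum]
    exact Finset.sum_congr rfl fun _ _ => by ring
  simp only [fullInner, hc, hm, mul_e_e, WithLp.ofLp_sum, Finset.sum_apply, PiLp.smul_apply,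
    PiLp.inner_apply, smul_eq_mul, ← sign_self]
  simp only [e, PiLp.single_apply]
  refine Finset.sum_congr rfl fun A _ => ?_
  rw [Finset.sum_eq_single A]
  · rw [symmDiff_self, Finset.bot_eq_empty, if_pos rfl, mul_one, sign_mul_self, mul_one]
  · intro B _ hB
    rw [if_neg, mul_zero, mul_zero, mul_zero]
    intro h
    exact hB (symmDiff_eq_bot.1 h.symm).symm
  · simp

/-! ### Paravectors and double sectors -/

/-- The paravectors `s₀ + s₁ e₁ + ⋯ + s_d e_d`. -/
def paravectors (d : ℕ) : Submodule ℝ (Number d) where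
  carrier := {s | ∀ A : Finset (Fin d), 2 ≤ A.card → s A = 0}
  add_mem' hs ht A hA := by simp [hs A hA, ht A hA]
  zero_mem' A _ := rfl
  smul_mem' c s hs A hA := by simp [hs A hA]

/-- The real part `s₀`. -/
def re (s : Number d) : ℝ := s ∅

/-- The imaginary part `s₁ e₁ + ⋯ + s_d e_d` of a paravector. -/
def im (s : Number d) : Number d := s - re s • e ∅

/-- The argument in `[0, π]` of a paravector `s = s₀ + J |Im s|`, `J` an imaginary unit: the
argument of the complex number `s₀ + i |Im s|`. -/
def arg (s : Number d) : ℝ := Complex.arg ⟨re s, ‖im s‖⟩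

/-- The open double sector `D_ω`, as a subset of the space of paravectors. -/
def doubleSector (d : ℕ) (ω : ℝ) : Set (paravectors d) :=
  {s | s ≠ 0 ∧ arg (s : Number d) ∈ Set.Ioo (-ω) ω ∪ Set.Ioo (Real.pi - ω) (Real.pi + ω)}

/-! ### Operators, the S-spectrum and bisectoriality

Operators in `V` are partially defined real-linear maps; right-linearity is the predicate
`IsRightLinear`. The adjoint of a densely defined operator with respect to the real inner product
is `LinearPMap.adjoint`. -/

/-- `dom(T)` is a right-linear subspace and `T (v s) = (T v) s`. -/
def IsRightLinear (T : HilbertModule d H →ₗ.[ℝ] HilbertModule d H) : Prop :=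
  ∀ (v : T.domain) (s : Number d),
    ∃ h : rightMul (v : HilbertModule d H) s ∈ T.domain, T ⟨_, h⟩ = rightMul (T v) s

/-- The class `K(V)` of closed right-linear operators. -/
def IsClosedRightLinear (T : HilbertModule d H →ₗ.[ℝ] HilbertModule d H) : Prop :=
  IsRightLinear T ∧ T.IsClosed

/-- `dom(T²) = {v ∈ dom(T) | T v ∈ dom(T)}`. -/
def sqDomain (T : HilbertModule d H →ₗ.[ℝ] HilbertModule d H) :
    Submodule ℝ (HilbertModule d H) :=
  (T.domain.comap T.toFun).map T.domain.subtype

theorem mem_sqDomain {T : HilbertModule d H →ₗ.[ℝ] HilbertModule d H} {v : HilbertModule d H} :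
    v ∈ sqDomain T ↔ ∃ h : v ∈ T.domain, T ⟨v, h⟩ ∈ T.domain := by
  simp [sqDomain]

theorem sqDomain_le (T : HilbertModule d H →ₗ.[ℝ] HilbertModule d H) : sqDomain T ≤ T.domain :=
  fun _ hv => (mem_sqDomain.1 hv).1

/-- `T` as a map from `dom(T²)` to `dom(T)`. -/
def sqStep (T : HilbertModule d H →ₗ.[ℝ] HilbertModule d H) : sqDomain T →ₗ[ℝ] T.domain :=
  (T.toFun ∘ₗ Submodule.inclusion (sqDomain_le T)).codRestrict T.domain
    fun v => (mem_sqDomain.1 v.2).2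

/-- `Q_s[T] = T² - 2 s₀ T + |s|²` with domain `dom(T²)`. -/
def Q (s : Number d) (T : HilbertModule d H →ₗ.[ℝ] HilbertModule d H) :
    HilbertModule d H →ₗ.[ℝ] HilbertModule d H where
  domain := sqDomain T
  toFun := T.toFun ∘ₗ sqStep T - (2 * re s) • (T.domain.subtype ∘ₗ sqStep T)
    + ‖s‖ ^ 2 • (sqDomain T).subtype

theorem Q_apply (s : Number d) (T : HilbertModule d H →ₗ.[ℝ] HilbertModule d H)
    (v : HilbertModule d H) (h : v ∈ T.domain) (h' : T ⟨v, h⟩ ∈ T.domain)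
    (hv : v ∈ (Q s T).domain) :
    Q s T ⟨v, hv⟩ = T ⟨T ⟨v, h⟩, h'⟩ - (2 * re s) • T ⟨v, h⟩ + ‖s‖ ^ 2 • v := rfl

/-- `B = P⁻¹ ∈ B(V)`: the operator `P` is bijective from its domain onto `V` with inverse `B`, and
`B` is bounded and right-linear. -/
structure IsBoundedInverse (P : HilbertModule d H →ₗ.[ℝ] HilbertModule d H)
    (B : HilbertModule d H →L[ℝ] HilbertModule d H) : Prop where
  map_rightMul : ∀ v (s : Number d), B (rightMul v s) = rightMul (B v) s
  right_inv : ∀ v, ∃ h : B v ∈ P.domain, P ⟨B v, h⟩ = v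
  left_inv : ∀ v : P.domain, B (P v) = v

/-- The S-resolvent set `ρ_S(T) = {s ∈ ℝ^{d+1} | Q_s[T]⁻¹ ∈ B(V)}`. -/
def resolventSet (T : HilbertModule d H →ₗ.[ℝ] HilbertModule d H) : Set (paravectors d) :=
  {s | ∃ B : HilbertModule d H →L[ℝ] HilbertModule d H, IsBoundedInverse (Q s T) B}

/-- The S-spectrum `σ_S(T) = ℝ^{d+1} ∖ ρ_S(T)`. -/
def spectrum (T : HilbertModule d H →ₗ.[ℝ] HilbertModule d H) : Set (paravectors d) :=
  (resolventSet T)ᶜ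

/-- The operator `Q_s[T]⁻¹` for `s ∈ ρ_S(T)`. -/
def Qinv (T : HilbertModule d H →ₗ.[ℝ] HilbertModule d H) (s : paravectors d)
    (hs : s ∈ resolventSet T) : HilbertModule d H →L[ℝ] HilbertModule d H :=
  hs.choose

theorem Qinv_spec (T : HilbertModule d H →ₗ.[ℝ] HilbertModule d H) (s : paravectors d)
    (hs : s ∈ resolventSet T) : IsBoundedInverse (Q s T) (Qinv T s hs) :=
  hs.choose_spec

theorem Qinv_mem_domain (T : HilbertModule d H →ₗ.[ℝ] HilbertModule d H) (s : paravectors d)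
    (hs : s ∈ resolventSet T) (v : HilbertModule d H) : Qinv T s hs v ∈ T.domain :=
  sqDomain_le T ((Qinv_spec T s hs).right_inv v).1

/-- The left S-resolvent operator `S_L⁻¹(s, T) v = Q_s[T]⁻¹ (conj(s) v) - T Q_s[T]⁻¹ v`,
for `s ∈ ρ_S(T)` and every `v ∈ V`. -/
def leftResolvent (T : HilbertModule d H →ₗ.[ℝ] HilbertModule d H) (s : paravectors d)
    (hs : s ∈ resolventSet T) (v : HilbertModule d H) : HilbertModule d H :=
  Qinv T s hs (leftMul (conj (s : Number d)) v) - T ⟨Qinv T s hs v, Qinv_mem_domain T s hs v⟩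

/-- `T ∈ K(V)` is bisectorial of angle `ω`: `σ_S(T)` lies in the closed double sector, and for
every `φ ∈ (ω, π/2)` there is `C ≥ 0` such that `‖S_L⁻¹(s, T)‖ ≤ C / |s|` for all paravectors
`s ∉ D_φ ∪ {0}`. The operator norm bound is written out pointwise. -/
structure IsBisectorial (T : HilbertModule d H →ₗ.[ℝ] HilbertModule d H) (ω : ℝ) : Prop where
  isClosedRightLinear : IsClosedRightLinear T
  spectrum_subset : spectrum T ⊆ closure (doubleSector d ω)
  resolvent_bound : ∀ φ ∈ Set.Ioo ω (Real.pi / 2), ∃ C : ℝ, 0 ≤ C ∧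
    ∀ s : paravectors d, s ∉ doubleSector d φ ∪ {0} → ∃ hs : s ∈ resolventSet T,
      ∀ v : HilbertModule d H, ‖leftResolvent T s hs v‖ ≤ C / ‖s‖ * ‖v‖

end Clifford

end

open scoped InnerProductSpace

noncomputable section

namespace Clifford

variable {d : ℕ} {H : Type*} [NormedAddCommGroup H] [InnerProductSpace ℝ H]

/-! ### Linearity and adjoints of the Clifford multiplications -/

/-! The operator `Q_s[T]` depends only on `s₀` and `|s|`, so `s` and `conj s` share the inverse `B =
Q_s[T]⁻¹`. The half sum and half difference of `S_L⁻¹` at these two points are, up to sign, `s₀ B -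
T B` and `B im(s)`. Left multiplication by the paravector `im(s)` is an isometry up to the factor
`|im s|`, with square `-|im s|²`. The resolvent estimate therefore bounds both `‖s₀ B - T B‖` and
`|im s| ‖B‖` by `C / |s|` (`component_bound`).

Density: let `w ⊥ dom(T)` and take `s` purely imaginary with `|s| → ∞`. Then `x = T B w` tends to
`0`, while `T x = w - |s|² B w` stays bounded. Moreover `⟪w, T x⟫ = ‖w‖²`, because `B w ∈ dom(T)`. A
weak cluster point `y` of the vectors `T x` gives `(0, y)` in the graph, which is closed and convex,
hence weakly closed. So `y = 0` and `‖w‖² = 0` (`eq_zero_of_inner_eq_const`).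

Adjoint: `T` commutes with `B` on `dom(T)`, which yields `Q_s[T*]⁻¹ = B*` and hence the spectral
inclusion. The operator `S_L⁻¹(s, T*) = B* conj(s) - (T B)*` is the adjoint of `s B - T B`. There
`s` stands to the left of `B`, so this is not a left resolvent of `T`, but the two component bounds
control it. -/

theorem leftMul_add_left (s t : Number d) (v : HilbertModule d H) :
    leftMul (s + t) v = leftMul s v + leftMul t v := by
  ext C
  simp [leftMul, mul_add, add_smul, Finset.sum_add_distrib]

theorem leftMul_smul_left (c : ℝ) (s : Number d) (v : HilbertModule d H) :
    leftMul (c • s) v = c • leftMul s v := by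
  ext C
  simp [leftMul, Finset.smul_sum, smul_smul, mul_left_comm]

theorem leftMul_smul_right (c : ℝ) (s : Number d) (v : HilbertModule d H) :
    leftMul s (c • v) = c • leftMul s v := by
  ext C
  simp [leftMul, Finset.smul_sum, smul_smul, mul_comm]

/-- Multiplication by `e_B` permutes the components up to signs, so reindexing by `C ↦ B ∆ C` moves
it to the other side. This costs the factor `sign B B`, which is the sign in `conj`. -/
theorem inner_leftMul (s : Number d) (v w : HilbertModule d H) :
    ⟪leftMul s v, w⟫_ℝ = ⟪v, leftMul (conj s) w⟫_ℝ := by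
  simp only [PiLp.inner_apply, leftMul, conj, sum_inner, inner_sum, inner_smul_left,
    inner_smul_right, ← sign_self, RCLike.conj_to_real]
  rw [Finset.sum_comm]
  conv_rhs => rw [Finset.sum_comm]
  refine Finset.sum_congr rfl fun B _ => ?_
  refine Finset.sum_nbij' (fun C => symmDiff B C) (fun C => symmDiff B C) (by simp) (by simp)
    (by simp) (by simp) fun C _ => ?_
  rw [symmDiff_symmDiff_cancel_left, sign_symmDiff_right]
  ring

theorem inner_rightMul (s : Number d) (v w : HilbertModule d H) :
    ⟪rightMul v s, w⟫_ℝ = ⟪v, rightMul w (conj s)⟫_ℝ := by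
  simp only [PiLp.inner_apply, rightMul, conj, sum_inner, inner_sum, inner_smul_left,
    inner_smul_right, ← sign_self, RCLike.conj_to_real]
  rw [Finset.sum_comm]
  conv_rhs => rw [Finset.sum_comm]
  refine Finset.sum_congr rfl fun B _ => ?_
  refine Finset.sum_nbij' (fun C => symmDiff B C) (fun C => symmDiff B C) (by simp) (by simp)
    (by simp) (by simp) fun C _ => ?_
  rw [symmDiff_symmDiff_cancel_left, sign_symmDiff_left]
  ring

theorem conj_conj (s : Number d) : conj (conj s) = s := by
  ext A
  simp only [conj, ← sign_self, ← mul_assoc, sign_mul_self, one_mul]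

/-! ### Paravectors -/

theorem conj_eq_of_mem_paravectors {s : Number d} (hs : s ∈ paravectors d) :
    conj s = re s • e ∅ - im s := by
  ext A
  rcases Nat.lt_or_ge A.card 2 with h | h
  · interval_cases hA : A.card
    · rw [Finset.card_eq_zero] at hA
      subst hA
      simp [conj, im, re, e]
    · have hA' : A ≠ ∅ := by rintro rfl; simp at hA
      simp [conj, im, re, e, hA, hA']
  · have hA' : A ≠ ∅ := by rintro rfl; simp at h
    simp [conj, im, re, e, hA', hs A h]

theorem leftMul_eq_re_add_im (s : Number d) (v : HilbertModule d H) :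
    leftMul s v = re s • v + leftMul (im s) v := by
  have h : s = re s • e ∅ + im s := by simp [im]
  conv_lhs => rw [h]
  rw [leftMul_add_left, leftMul_smul_left, leftMul_e_empty]

theorem e_empty_mem_paravectors : (e ∅ : Number d) ∈ paravectors d := by
  intro A hA
  have hA' : A ≠ ∅ := by rintro rfl; simp at hA
  simp [e, hA']

theorem im_mem_paravectors {s : Number d} (hs : s ∈ paravectors d) : im s ∈ paravectors d :=
  sub_mem hs (Submodule.smul_mem _ _ e_empty_mem_paravectors)

theorem conj_mem_paravectors {s : Number d} (hs : s ∈ paravectors d) :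
    conj s ∈ paravectors d := by
  rw [conj_eq_of_mem_paravectors hs]
  exact sub_mem (Submodule.smul_mem _ _ e_empty_mem_paravectors) (im_mem_paravectors hs)

theorem re_conj (s : Number d) : re (conj s) = re s := by simp [re, conj]

theorem im_conj {s : Number d} (hs : s ∈ paravectors d) : im (conj s) = -im s := by
  rw [im, re_conj, conj_eq_of_mem_paravectors hs]
  abel

theorem re_im (s : Number d) : re (im s) = 0 := by simp [re, im, e]

theorem norm_conj (s : Number d) : ‖conj s‖ = ‖s‖ := by
  simp [EuclideanSpace.norm_eq, conj]

theorem mul_conj_self {s : Number d} (hs : s ∈ paravectors d) :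
    mul (conj s) s = ‖s‖ ^ 2 • e ∅ := by
  ext C
  simp only [mul, leftMul, conj, ← sign_self, smul_eq_mul, PiLp.smul_apply]
  rw [EuclideanSpace.norm_sq_eq]
  have key (B : Finset (Fin d)) : sign B (symmDiff B C) * (sign B B * s B) * s (symmDiff B C)
      = sign B C * (s B * s (symmDiff B C)) := by
    rw [sign_symmDiff_right]
    linear_combination (sign B C * (s B * s (symmDiff B C))) * sign_mul_self B B
  simp only [key]
  by_cases hC : C = ∅
  · subst hC
    simp [e, sign, sq, show ∀ B : Finset (Fin d), symmDiff B ∅ = B from symmDiff_bot]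
  · rw [show (e ∅ : Number d) C = 0 by simp [e, hC], mul_zero]
    -- The off-scalar coefficients cancel in pairs under `B ↔ B ∆ C`. For a paravector only `B` and
    -- `B ∆ C` of size at most one contribute, so `C` has one or two elements and `sign C C = -1`.
    have h2 : ∑ B, sign B C * (s B * s (symmDiff B C))
        = ∑ B, -(sign B C * (s B * s (symmDiff B C))) := by
      refine Finset.sum_nbij' (fun B => symmDiff B C) (fun B => symmDiff B C) (by simp) (by simp)
        (by simp) (by simp) fun B _ => ?_
      rw [symmDiff_symmDiff_cancel_right, sign_symmDiff_left]
      rcases Nat.lt_or_ge B.card 2 with h | h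
      · rcases Nat.lt_or_ge (symmDiff B C).card 2 with h' | h'
        · have hc : C.card ≤ 2 := by
            have : C ⊆ B ∪ symmDiff B C := fun x hx => by
              by_cases hB : x ∈ B <;> simp [Finset.mem_symmDiff, hB, hx]
            have := (Finset.card_le_card this).trans (Finset.card_union_le _ _)
            omega
          have hc0 : 0 < C.card := Finset.card_pos.2 (Finset.nonempty_iff_ne_empty.2 hC)
          have : sign C C = -1 := by
            rw [sign_self]
            interval_cases C.card <;> norm_num
          rw [this]; ring
        · simp [hs _ h']
      · simp [hs _ h]
    rw [Finset.sum_neg_distrib] at h2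
    linarith

/-- Left multiplication by `conj s` is the adjoint, and `conj(s) s = |s|²` holds for paravectors. -/
theorem norm_leftMul {s : Number d} (hs : s ∈ paravectors d) (v : HilbertModule d H) :
    ‖leftMul s v‖ = ‖s‖ * ‖v‖ := by
  rw [← sq_eq_sq₀ (norm_nonneg _) (by positivity), ← real_inner_self_eq_norm_sq, inner_leftMul,
    leftMul_leftMul, mul_conj_self hs, leftMul_smul_left, leftMul_e_empty, inner_smul_right,
    real_inner_self_eq_norm_sq, mul_pow]

/-- Conjugation fixes `re s` and `‖im s‖`, the only data entering `arg`. The resolvent bound is thus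
available at `conj s` too. -/
theorem conj_notMem_doubleSector {s : paravectors d} {φ : ℝ}
    (hs : s ∉ doubleSector d φ ∪ {0}) :
    (⟨conj s, conj_mem_paravectors s.2⟩ : paravectors d) ∉ doubleSector d φ ∪ {0} := by
  have h0 : (⟨conj s, conj_mem_paravectors s.2⟩ : paravectors d) = 0 ↔ s = 0 := by
    rw [← norm_eq_zero, Submodule.coe_norm, norm_conj, ← Submodule.coe_norm, norm_eq_zero]
  simpa only [doubleSector, Set.mem_union, Set.mem_ofPred_eq, Set.mem_singleton_iff, h0, ne_eq, arg, re_conj,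
    im_conj s.2, norm_neg] using hs

/-- A purely imaginary paravector lies outside all double sectors of angle less than `π / 2`. -/
theorem exists_imaginary_notMem_doubleSector (hd : 1 ≤ d) {t : ℝ} (ht : 0 < t) {φ : ℝ}
    (hφ : φ < Real.pi / 2) :
    ∃ s : paravectors d, s ∉ doubleSector d φ ∪ {0} ∧ re (s : Number d) = 0 ∧ ‖s‖ = t := by
  -- An imaginary unit exists only because `d ≥ 1`.
  have hmem : (t • e {⟨0, hd⟩} : Number d) ∈ paravectors d := by
    refine Submodule.smul_mem _ _ fun A hA => ?_
    have hA' : A ≠ {⟨0, hd⟩} := by rintro rfl; simp at hA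
    simp [e, hA']
  have hre : re (t • e {⟨0, hd⟩} : Number d) = 0 := by
    simp [re, e, (Finset.singleton_ne_empty _).symm]
  have hn : ‖(t • e {⟨0, hd⟩} : Number d)‖ = t := by
    simp [norm_smul, e, abs_of_pos ht]
  have him : im (t • e {⟨0, hd⟩} : Number d) = t • e {⟨0, hd⟩} := by
    rw [im, hre, zero_smul, sub_zero]
  refine ⟨⟨_, hmem⟩, ?_, hre, hn⟩
  have harg : arg (t • e {⟨0, hd⟩} : Number d) = Real.pi / 2 := by
    rw [arg, hre, him, hn]
    exact Complex.arg_eq_pi_div_two_iff.2 ⟨rfl, ht⟩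
  rintro (⟨-, h⟩ | h)
  · change arg (t • e {⟨0, hd⟩} : Number d) ∈ _ at h
    rw [harg] at h
    rcases h with h | h
    · linarith [h.2]
    · linarith [h.1]
  · have h' : (t • e {⟨0, hd⟩} : Number d) = 0 := congrArg Subtype.val h
    rw [h', norm_zero] at hn
    exact ht.ne hn

/-! ### Closed operators -/

section Closed

variable {E : Type*} [NormedAddCommGroup E] [InnerProductSpace ℝ E] [CompleteSpace E]

/-- If `x n → 0` and `T (x n)` is bounded, then no constant sequence `⟪w, T (x n)⟫` is nonzero:
by weak compactness and closedness of the graph, `0` is a weak cluster point of `T (x n)`. -/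
theorem eq_zero_of_inner_eq_const {T : E →ₗ.[ℝ] E} (hT : T.IsClosed) (x : ℕ → T.domain)
    (hx : Filter.Tendsto (fun n => (x n : E)) Filter.atTop (nhds 0)) {M : ℝ}
    (hM : ∀ n, ‖T (x n)‖ ≤ M) {w : E} {c : ℝ} (hc : ∀ n, ⟪w, T (x n)⟫_ℝ = c) : c = 0 := by
  -- Limits along an ultrafilter replace weakly convergent subsequences; Banach–Alaoglu supplies the
  -- limit functional, represented by `y`.
  let U : Ultrafilter ℕ := Ultrafilter.of Filter.atTop
  have hU : (U : Filter ℕ) ≤ Filter.atTop := Ultrafilter.of_le _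
  let g : ℕ → WeakDual ℝ E := fun n =>
    StrongDual.toWeakDual (InnerProductSpace.toDual ℝ E (T (x n)))
  obtain ⟨f, -, hf⟩ := (WeakDual.isCompact_closedBall (𝕜 := ℝ) (E := E) 0 M).ultrafilter_le_nhds
    (U.map g) (by
      rw [Filter.le_principal_iff, Ultrafilter.coe_map, Filter.mem_map]
      refine Filter.Eventually.of_forall fun n => ?_
      simpa [g] using hM n)
  have hlim (v : E) : Filter.Tendsto (fun n => ⟪T (x n), v⟫_ℝ) U (nhds (f v)) :=
    ((WeakDual.eval_continuous v).tendsto f).comp hf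
  obtain ⟨y, hy⟩ := (InnerProductSpace.toDual ℝ E).surjective (WeakDual.toStrongDual f)
  have hfy (v : E) : f v = ⟪y, v⟫_ℝ := by
    rw [← InnerProductSpace.toDual_apply_apply, hy]; rfl
  -- A functional strictly separating `(0, y)` from the graph would contradict the convergence of
  -- its values at `(x n, T (x n))` to its value at `(0, y)`.
  have hy0 : ((0 : E), y) ∈ T.graph := by
    by_contra hn
    obtain ⟨l, u, hl, hlu⟩ := geometric_hahn_banach_closed_point T.graph.convex hT hn
    let i : E →L[ℝ] ℝ := l.comp (ContinuousLinearMap.inr ℝ E E)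
    have hi (v : E) : i v = ⟪v, (InnerProductSpace.toDual ℝ E).symm i⟫_ℝ := by
      rw [real_inner_comm, InnerProductSpace.toDual_symm_apply]
    have h1 : Filter.Tendsto (fun n => i (T (x n))) U (nhds (i y)) := by
      simp only [hi, ← hfy]
      exact hlim _
    have h2 := (((l.comp (ContinuousLinearMap.inl ℝ E E)).continuous.tendsto 0).comp hx).mono_left hU
    rw [map_zero] at h2
    have h3 := h2.add h1
    rw [zero_add] at h3
    refine hlu.not_ge (le_of_tendsto h3 (Filter.Eventually.of_forall fun n => ?_))
    have h4 := hl _ (T.mem_graph (x n))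
    have h5 : ((x n : E), T (x n)) = ((x n : E), 0) + (0, T (x n)) := by simp
    rw [h5, map_add] at h4
    exact h4.le
  have hy0' : y = 0 := by
    obtain ⟨z, hz, hz'⟩ := (T.mem_graph_iff).1 hy0
    have : z = 0 := Subtype.ext hz
    exact hz'.symm.trans (by rw [this, T.map_zero])
  have := hlim w
  rw [hfy, hy0', inner_zero_left] at this
  refine tendsto_nhds_unique ?_ this
  simp only [real_inner_comm, hc]
  exact tendsto_const_nhds

end Closed

/-! ### The inverse of `Q_s[T]` -/

namespace IsBoundedInverse

theorem eq {P : HilbertModule d H →ₗ.[ℝ] HilbertModule d H}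
    {B B' : HilbertModule d H →L[ℝ] HilbertModule d H} (h : IsBoundedInverse P B)
    (h' : IsBoundedInverse P B') : B = B' := by
  ext1 v
  obtain ⟨hv, hv'⟩ := h'.right_inv v
  have := h.left_inv ⟨B' v, hv⟩
  rwa [hv'] at this

variable {T : HilbertModule d H →ₗ.[ℝ] HilbertModule d H} {s : Number d}
  {B : HilbertModule d H →L[ℝ] HilbertModule d H}

theorem mem_domain (hB : IsBoundedInverse (Q s T) B) (v : HilbertModule d H) :
    B v ∈ T.domain :=
  sqDomain_le T (hB.right_inv v).1

theorem apply_mem_domain (hB : IsBoundedInverse (Q s T) B) (v : HilbertModule d H) :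
    T ⟨B v, hB.mem_domain v⟩ ∈ T.domain :=
  (mem_sqDomain.1 (hB.right_inv v).1).2

theorem apply_apply (hB : IsBoundedInverse (Q s T) B) (v : HilbertModule d H) :
    T ⟨T ⟨B v, hB.mem_domain v⟩, hB.apply_mem_domain v⟩
      = v + (2 * re s) • T ⟨B v, hB.mem_domain v⟩ - ‖s‖ ^ 2 • B v := by
  obtain ⟨h, h'⟩ := hB.right_inv v
  rw [Q_apply s T (B v) (hB.mem_domain v) (hB.apply_mem_domain v) h] at h'
  rw [eq_sub_iff_add_eq, ← sub_eq_iff_eq_add, add_sub_right_comm]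
  exact h'

/-- `T` commutes with `Q_s[T]⁻¹` on `dom(T)`. -/
theorem apply_comm (hB : IsBoundedInverse (Q s T) B) (u : T.domain) :
    B (T u) = T ⟨B u, hB.mem_domain u⟩ := by
  -- For `u ∈ dom(T)` the formula for `T² B u` stays in `dom(T)`. So `T B u ∈ dom(T²)` and `Q_s[T] T
  -- B u = T Q_s[T] B u = T u`; applying `B` gives the claim.
  have h1 : T ⟨T ⟨B u, hB.mem_domain u⟩, hB.apply_mem_domain u⟩ ∈ T.domain := by
    rw [hB.apply_apply]
    exact sub_mem (add_mem u.2 (Submodule.smul_mem _ _ (hB.apply_mem_domain u)))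
      (Submodule.smul_mem _ _ (hB.mem_domain u))
  have h2 : T ⟨B u, hB.mem_domain u⟩ ∈ (Q s T).domain :=
    mem_sqDomain.2 ⟨hB.apply_mem_domain u, h1⟩
  have h3 := hB.left_inv ⟨_, h2⟩
  rw [Q_apply s T _ (hB.apply_mem_domain u) h1 h2] at h3
  refine Eq.trans (congrArg B ?_) h3
  have h4 : (⟨_, h1⟩ : T.domain) = u + (2 * re s) • ⟨_, hB.apply_mem_domain u⟩
      - ‖s‖ ^ 2 • ⟨_, hB.mem_domain u⟩ := Subtype.ext (hB.apply_apply u)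
  rw [h4, T.map_sub, T.map_add, T.map_smul, T.map_smul]
  abel

/-- The bounded operator `T Q_s[T]⁻¹`. -/
def comp [CompleteSpace H] (hB : IsBoundedInverse (Q s T) B) (hT : T.IsClosed) :
    HilbertModule d H →L[ℝ] HilbertModule d H where
  toLinearMap := T.toFun ∘ₗ B.toLinearMap.codRestrict T.domain hB.mem_domain
  cont := by
    -- Closed graph theorem: the graph of `T B` is the preimage of that of `T` under the continuous
    -- map `(v, w) ↦ (B v, w)`.
    refine LinearMap.continuous_of_isClosed_graph _ ?_
    have : ((T.toFun ∘ₗ B.toLinearMap.codRestrict T.domain hB.mem_domain).graph :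
        Set (HilbertModule d H × HilbertModule d H))
        = (fun p => (B p.1, p.2)) ⁻¹' (T.graph : Set _) := by
      ext ⟨v, w⟩
      simp only [SetLike.mem_coe, LinearMap.mem_graph_iff, Set.mem_preimage, T.mem_graph_iff]
      constructor
      · intro h
        exact ⟨⟨B v, hB.mem_domain v⟩, rfl, h.symm⟩
      · rintro ⟨y, hy, hy'⟩
        rw [← hy']
        exact congrArg T (Subtype.ext hy)
    rw [this]
    exact hT.preimage (by fun_prop)

theorem comp_apply [CompleteSpace H] (hB : IsBoundedInverse (Q s T) B) (hT : T.IsClosed)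
    (v : HilbertModule d H) : hB.comp hT v = T ⟨B v, hB.mem_domain v⟩ := rfl

variable [CompleteSpace H]

/-- `(Q_s[T]⁻¹)* w ∈ dom(T*)` and `T* (Q_s[T]⁻¹)* = (T Q_s[T]⁻¹)*`. -/
theorem adjoint_apply (hB : IsBoundedInverse (Q s T) B) (hT : T.IsClosed)
    (hd : Dense (T.domain : Set (HilbertModule d H))) (w : HilbertModule d H) :
    ∃ h : B.adjoint w ∈ T.adjoint.domain,
      T.adjoint ⟨B.adjoint w, h⟩ = (hB.comp hT).adjoint w := by
  have key (u : T.domain) : ⟪(hB.comp hT).adjoint w, (u : HilbertModule d H)⟫_ℝ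
      = ⟪B.adjoint w, T u⟫_ℝ := by
    rw [ContinuousLinearMap.adjoint_inner_left, ContinuousLinearMap.adjoint_inner_left,
      hB.comp_apply, hB.apply_comm]
  exact ⟨LinearPMap.mem_adjoint_domain_of_exists _ ⟨_, key⟩, LinearPMap.adjoint_apply_eq hd _ key⟩

/-- This is the dual of `apply_apply`: for `u ∈ dom(T)` one has `T B T u = T² B u`, and each term on
the right of that formula is bounded, so it can be moved to `w`. -/
theorem adjoint_comp_apply (hB : IsBoundedInverse (Q s T) B) (hT : T.IsClosed)
    (hd : Dense (T.domain : Set (HilbertModule d H))) (w : HilbertModule d H) :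
    ∃ h : (hB.comp hT).adjoint w ∈ T.adjoint.domain,
      T.adjoint ⟨(hB.comp hT).adjoint w, h⟩
        = w + (2 * re s) • (hB.comp hT).adjoint w - ‖s‖ ^ 2 • B.adjoint w := by
  have key (u : T.domain) :
      ⟪w + (2 * re s) • (hB.comp hT).adjoint w - ‖s‖ ^ 2 • B.adjoint w,
        (u : HilbertModule d H)⟫_ℝ = ⟪(hB.comp hT).adjoint w, T u⟫_ℝ := by
    have h : hB.comp hT (T u) = T ⟨_, hB.apply_mem_domain u⟩ := by
      rw [hB.comp_apply]
      exact congrArg T (Subtype.ext (hB.apply_comm u))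
    rw [ContinuousLinearMap.adjoint_inner_left, h, hB.apply_apply, inner_sub_left, inner_add_left,
      inner_sub_right, inner_add_right, real_inner_smul_left, real_inner_smul_left,
      real_inner_smul_right, real_inner_smul_right, ContinuousLinearMap.adjoint_inner_left,
      ContinuousLinearMap.adjoint_inner_left, hB.comp_apply]
  exact ⟨LinearPMap.mem_adjoint_domain_of_exists _ ⟨_, key⟩, LinearPMap.adjoint_apply_eq hd _ key⟩

/-- `Q_s[T*]⁻¹ = (Q_s[T]⁻¹)*`. -/
theorem adjoint (hB : IsBoundedInverse (Q s T) B) (hT : T.IsClosed)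
    (hd : Dense (T.domain : Set (HilbertModule d H))) :
    IsBoundedInverse (Q s T.adjoint) B.adjoint where
  map_rightMul v t := by
    refine ext_inner_right ℝ fun w => ?_
    rw [ContinuousLinearMap.adjoint_inner_left, inner_rightMul, inner_rightMul,
      ContinuousLinearMap.adjoint_inner_left, hB.map_rightMul]
  right_inv v := by
    obtain ⟨h1, h2⟩ := hB.adjoint_apply hT hd v
    obtain ⟨h3, h4⟩ := hB.adjoint_comp_apply hT hd v
    have h5 : T.adjoint ⟨B.adjoint v, h1⟩ ∈ T.adjoint.domain := by rwa [h2]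
    have h6 : T.adjoint ⟨T.adjoint ⟨B.adjoint v, h1⟩, h5⟩
        = v + (2 * re s) • (hB.comp hT).adjoint v - ‖s‖ ^ 2 • B.adjoint v := by
      rw [← h4]
      exact congrArg T.adjoint (Subtype.ext h2)
    have h7 : B.adjoint v ∈ (Q s T.adjoint).domain := mem_sqDomain.2 ⟨h1, h5⟩
    refine ⟨h7, ?_⟩
    rw [Q_apply s T.adjoint _ h1 h5 h7, h6, h2]
    abel
  left_inv v := by
    obtain ⟨v, hv⟩ := v
    obtain ⟨h1, h2⟩ := mem_sqDomain.1 hv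
    -- Since `B w ∈ dom(T²)`, both factors of `T*` can be moved across: `⟪Q_s[T*] v, B w⟫ = ⟪v,
    -- Q_s[T] B w⟫ = ⟪v, w⟫`.
    refine ext_inner_right ℝ fun w => ?_
    have hadj := LinearPMap.adjoint_isFormalAdjoint hd
    rw [ContinuousLinearMap.adjoint_inner_left, Q_apply s T.adjoint v h1 h2 hv, inner_add_left,
      inner_sub_left, real_inner_smul_left, real_inner_smul_left,
      hadj ⟨_, h2⟩ ⟨_, hB.mem_domain w⟩, hadj ⟨_, h1⟩ ⟨_, hB.mem_domain w⟩]
    have h3 := hadj ⟨_, h1⟩ ⟨_, hB.apply_mem_domain w⟩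
    rw [hB.apply_apply] at h3
    simp only [inner_sub_right, inner_add_right, real_inner_smul_right] at h3 ⊢
    linarith

end IsBoundedInverse

/-! ### Bounds for bisectorial operators -/

theorem Q_conj (s : Number d) (T : HilbertModule d H →ₗ.[ℝ] HilbertModule d H) :
    Q (conj s) T = Q s T := by
  simp only [Q, re_conj, norm_conj]

/-- The resolvent bounds at `s` and `conj s` bound the components of the resolvent. -/
theorem IsBisectorial.component_bound {T : HilbertModule d H →ₗ.[ℝ] HilbertModule d H} {ω : ℝ}
    (hT : IsBisectorial T ω) {φ : ℝ} (hφ : φ ∈ Set.Ioo ω (Real.pi / 2)) :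
    ∃ C : ℝ, 0 ≤ C ∧ ∀ s : paravectors d, s ∉ doubleSector d φ ∪ {0} →
      ∃ hs : s ∈ resolventSet T, ∀ v : HilbertModule d H,
        ‖re (s : Number d) • Qinv T s hs v - T ⟨_, Qinv_mem_domain T s hs v⟩‖ ≤ C / ‖s‖ * ‖v‖ ∧
        ‖im (s : Number d)‖ * ‖Qinv T s hs v‖ ≤ C / ‖s‖ * ‖v‖ := by
  obtain ⟨C, hC, hb⟩ := hT.resolvent_bound φ hφ
  refine ⟨C, hC, fun s hsφ => ?_⟩
  obtain ⟨hs, h1⟩ := hb s hsφ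
  obtain ⟨hs', h2⟩ := hb _ (conj_notMem_doubleSector hsφ)
  have hQ : Qinv T _ hs' = Qinv T s hs := by
    have := Qinv_spec T _ hs'
    rw [Q_conj] at this
    exact this.eq (Qinv_spec T s hs)
  have hn : ‖(⟨conj s, conj_mem_paravectors s.2⟩ : paravectors d)‖ = ‖s‖ := norm_conj _
  simp only [leftResolvent, hQ, hn, conj_conj] at h2
  simp only [leftResolvent] at h1
  set B := Qinv T s hs
  have e1 (v : HilbertModule d H) : B (leftMul (s : Number d) v)
      = re (s : Number d) • B v + B (leftMul (im (s : Number d)) v) := by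
    rw [leftMul_eq_re_add_im, map_add, map_smul]
  have e2 (v : HilbertModule d H) : B (leftMul (conj (s : Number d)) v)
      = re (s : Number d) • B v - B (leftMul (im (s : Number d)) v) := by
    rw [conj_eq_of_mem_paravectors s.2, sub_eq_add_neg, leftMul_add_left, leftMul_smul_left,
      leftMul_e_empty, ← neg_one_smul ℝ (im _), leftMul_smul_left, map_add, map_smul, map_smul,
      neg_one_smul, ← sub_eq_add_neg]
  -- The difference of the two resolvents is `2 B im(s)`; the sum, used below, is `2 (s₀ B - T B)`.
  have him (v : HilbertModule d H) : ‖B (leftMul (im (s : Number d)) v)‖ ≤ C / ‖s‖ * ‖v‖ := by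
    have h := norm_sub_le_of_le (h2 v) (h1 v)
    rw [e1, e2] at h
    have h' := norm_smul (2 : ℝ) (B (leftMul (im (s : Number d)) v))
    rw [two_smul, Real.norm_of_nonneg zero_le_two] at h'
    have h'' : ∀ a b c : HilbertModule d H, a + b - c - (a - b - c) = b + b := fun a b c => by abel
    rw [h''] at h
    linarith
  refine ⟨hs, fun v => ⟨?_, ?_⟩⟩
  · have h := norm_add_le_of_le (h2 v) (h1 v)
    rw [e1, e2] at h
    have h' := norm_smul (2 : ℝ) (re (s : Number d) • B v - T ⟨_, Qinv_mem_domain T s hs v⟩)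
    rw [two_smul, Real.norm_of_nonneg zero_le_two] at h'
    have h'' : ∀ a b c : HilbertModule d H, a + b - c + (a - b - c) = a - c + (a - c) :=
      fun a b c => by abel
    rw [h''] at h
    linarith
  -- To strip `im(s)` from `B im(s)`, evaluate at `-im(s) v`: this gives `|im s|² ‖B v‖ ≤ C / |s| *
  -- |im s| ‖v‖`, and one factor `|im s|` cancels.
  · have hp := im_mem_paravectors s.2
    have hconj : conj (im (s : Number d)) = (-1 : ℝ) • im (s : Number d) := by
      rw [conj_eq_of_mem_paravectors hp, re_im, im, re_im]; simp
    have h := mul_conj_self hp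
    rw [hconj] at h
    have h3 := him (leftMul ((-1 : ℝ) • im (s : Number d)) v)
    rw [leftMul_smul_left, leftMul_smul_right, ← leftMul_smul_left, leftMul_leftMul, h,
      leftMul_smul_left, leftMul_e_empty, map_smul, norm_smul, norm_smul, norm_leftMul hp] at h3
    rcases (norm_nonneg (im (s : Number d))).eq_or_lt with h0 | h0
    · rw [← h0, zero_mul]; positivity
    · refine le_of_mul_le_mul_left ?_ h0
      norm_num at h3
      change _ ≤ C / ‖s‖ * _ at h3
      change _ * (_ * ‖B v‖) ≤ _
      linarith

variable [CompleteSpace H]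

/-! ### Density of the domain -/

theorem IsBisectorial.dense_domain (hd : 1 ≤ d) {T : HilbertModule d H →ₗ.[ℝ] HilbertModule d H}
    {ω : ℝ} (hω : ω < Real.pi / 2) (hT : IsBisectorial T ω) :
    Dense (T.domain : Set (HilbertModule d H)) := by
  rw [Submodule.dense_iff_topologicalClosure_eq_top,
    Submodule.topologicalClosure_eq_top_iff, Submodule.eq_bot_iff]
  intro w hw
  obtain ⟨φ, hφ⟩ := exists_between hω
  obtain ⟨C, hC, hb⟩ := hT.component_bound hφ
  choose s hs hre hnorm using fun n : ℕ =>
    exists_imaginary_notMem_doubleSector hd (Nat.cast_add_one_pos (α := ℝ) n) hφ.2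
  choose hr hbd using fun n => hb (s n) (hs n)
  have hB n := Qinv_spec T (s n) (hr n)
  let x (n : ℕ) : T.domain := ⟨_, (hB n).apply_mem_domain w⟩
  have hTx (n : ℕ) : T (x n) = w - ‖s n‖ ^ 2 • Qinv T (s n) (hr n) w := by
    have := (hB n).apply_apply w
    rw [hre, mul_zero, zero_smul, add_zero] at this
    exact this
  have hxn (n : ℕ) : ‖(x n : HilbertModule d H)‖ ≤ C / (n + 1) * ‖w‖ := by
    have := (hbd n w).1
    rwa [hre, zero_smul, zero_sub, norm_neg, hnorm] at this
  have hx : Filter.Tendsto (fun n => (x n : HilbertModule d H)) Filter.atTop (nhds 0) := by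
    refine squeeze_zero_norm hxn ?_
    have := ((tendsto_one_div_add_atTop_nhds_zero_nat (𝕜 := ℝ)).const_mul C).mul_const ‖w‖
    simpa [div_eq_mul_inv] using this
  -- For imaginary `s` one has `|im s| = |s|`, so the second component bound reads `|s|² ‖B w‖ ≤ C
  -- ‖w‖`.
  have hM (n : ℕ) : ‖T (x n)‖ ≤ ‖w‖ + C * ‖w‖ := by
    have him : ‖im (s n : Number d)‖ = ‖s n‖ := by
      rw [im, hre, zero_smul, sub_zero]; rfl
    have h0 : 0 < ‖s n‖ := by rw [hnorm]; positivity
    have h1 := (hbd n w).2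
    rw [him] at h1
    have h2 := mul_le_mul_of_nonneg_left h1 h0.le
    rw [← mul_assoc, ← mul_assoc, mul_div_cancel₀ _ h0.ne'] at h2
    rw [hTx]
    refine (norm_sub_le _ _).trans (add_le_add_right ?_ _)
    rw [norm_smul, norm_pow, norm_norm, sq]
    exact h2
  have hc (n : ℕ) : ⟪w, T (x n)⟫_ℝ = ‖w‖ ^ 2 := by
    rw [hTx, inner_sub_right, real_inner_smul_right, real_inner_self_eq_norm_sq, real_inner_comm,
      hw _ ((hB n).mem_domain w), mul_zero, sub_zero]
  simpa using eq_zero_of_inner_eq_const hT.isClosedRightLinear.2 x hx hM hc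

/-! ### The adjoint of a bisectorial operator -/

theorem IsRightLinear.adjoint {T : HilbertModule d H →ₗ.[ℝ] HilbertModule d H}
    (hd : Dense (T.domain : Set (HilbertModule d H))) (hT : IsRightLinear T) :
    IsRightLinear T.adjoint := by
  intro w s
  -- Right multiplication by `s` has adjoint right multiplication by `conj s`, with which `T`
  -- commutes.
  have key (u : T.domain) : ⟪rightMul (T.adjoint w) s, (u : HilbertModule d H)⟫_ℝ
      = ⟪rightMul (w : HilbertModule d H) s, T u⟫_ℝ := by
    obtain ⟨h, h'⟩ := hT u (conj s)
    rw [inner_rightMul, inner_rightMul, ← h']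
    exact LinearPMap.adjoint_isFormalAdjoint hd w ⟨_, h⟩
  exact ⟨LinearPMap.mem_adjoint_domain_of_exists _ ⟨_, key⟩, LinearPMap.adjoint_apply_eq hd _ key⟩

theorem IsBisectorial.adjoint {T : HilbertModule d H →ₗ.[ℝ] HilbertModule d H} {ω : ℝ}
    (hd : Dense (T.domain : Set (HilbertModule d H))) (hT : IsBisectorial T ω) :
    IsBisectorial T.adjoint ω := by
  have hcl := hT.isClosedRightLinear.2
  have hres : resolventSet T ⊆ resolventSet T.adjoint := fun s ⟨B, hB⟩ =>
    ⟨B.adjoint, hB.adjoint hcl hd⟩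
  refine ⟨⟨hT.isClosedRightLinear.1.adjoint hd, LinearPMap.adjoint_isClosed hd⟩,
    (Set.compl_subset_compl.2 hres).trans hT.spectrum_subset, fun φ hφ => ?_⟩
  obtain ⟨C, hC, hb⟩ := hT.component_bound hφ
  -- One `C` comes from `s₀ B - T B`, the other from `im(s) B`.
  refine ⟨2 * C, by positivity, fun s hs => ?_⟩
  obtain ⟨hr, hbd⟩ := hb s hs
  refine ⟨hres hr, fun w => ?_⟩
  have hB := Qinv_spec T s hr
  set B := Qinv T s hr
  have hQ : Qinv T.adjoint s (hres hr) = B.adjoint :=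
    (Qinv_spec T.adjoint s (hres hr)).eq (hB.adjoint hcl hd)
  obtain ⟨h1, h2⟩ := hB.adjoint_apply hcl hd w
  have hx : leftResolvent T.adjoint s (hres hr) w
      = B.adjoint (leftMul (conj (s : Number d)) w) - (hB.comp hcl).adjoint w := by
    simp only [leftResolvent, hQ, h2]
  set x := leftResolvent T.adjoint s (hres hr) w
  have hR : ‖leftMul (s : Number d) (B x) - hB.comp hcl x‖ ≤ 2 * C / ‖s‖ * ‖x‖ := by
    obtain ⟨hb1, hb2⟩ := hbd x
    have : leftMul (s : Number d) (B x) - hB.comp hcl x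
        = (re (s : Number d) • B x - hB.comp hcl x) + leftMul (im (s : Number d)) (B x) := by
      rw [leftMul_eq_re_add_im]
      abel
    rw [this]
    refine (norm_add_le_of_le hb1 ((norm_leftMul (im_mem_paravectors s.2) _).trans_le hb2)).trans
      (le_of_eq ?_)
    ring
  -- The norm of an adjoint is bounded by testing against its own value `x`; one factor `‖x‖`
  -- cancels at the end.
  have hxx : ⟪x, x⟫_ℝ = ⟪w, leftMul (s : Number d) (B x) - hB.comp hcl x⟫_ℝ := by
    have h := congrArg (fun y => ⟪y, x⟫_ℝ) hx
    refine h.trans ?_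
    rw [inner_sub_left, ContinuousLinearMap.adjoint_inner_left,
      ContinuousLinearMap.adjoint_inner_left, inner_leftMul, conj_conj, inner_sub_right]
  have h3 : ‖x‖ * ‖x‖ ≤ ‖w‖ * (2 * C / ‖s‖ * ‖x‖) := by
    rw [← real_inner_self_eq_norm_mul_norm, hxx]
    exact (real_inner_le_norm _ _).trans (mul_le_mul_of_nonneg_left hR (norm_nonneg _))
  rcases (norm_nonneg x).eq_or_lt with h0 | h0
  · rw [← h0]; positivity
  · refine le_of_mul_le_mul_right ?_ h0
    linarith

end Clifford

end

theorem mainTheorem5 {d : ℕ} (hd : 1 ≤ d) {H : Type*} [NormedAddCommGroup H]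
    [InnerProductSpace ℝ H] [CompleteSpace H]
    (T : Clifford.HilbertModule d H →ₗ.[ℝ] Clifford.HilbertModule d H)
    (ω : ℝ) (hω : ω ∈ Set.Ioo 0 (Real.pi / 2)) (hT : Clifford.IsBisectorial T ω) :
    Dense (T.domain : Set (Clifford.HilbertModule d H)) ∧
      Clifford.IsBisectorial T.adjoint ω := by
  have hdense := hT.dense_domain hd hω.2
  exact ⟨hdense, hT.adjoint hdense⟩
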